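/- **Theorem 4.1.** Let $\alpha^+,\lambda^+,\alpha^-,\lambda^->0$, and consider the bilateral Gamma distribution with these parameters, that is, the law of $X-Y$ where $X$ and $Y$ are independent, $X\sim\Gamma(\alpha^+,\lambda^+)$ and $Y\sim\Gamma(\alpha^-,\lambda^-)$ (shape $\alpha^\pm$, rate $\lambda^\pm$). Let $N\in\mathbb{N}_0$ be the unique nonnegative integer with $N<\alpha^++\alpha^-\le N+1$. Let $g_{\alpha,\lambda}(y)=\frac{\lambda^\alpha}{\Gamma(\alpha)}y^{\alpha-1}e^{-\lambda y}\mathbf{1}_{(0,\infty)}(y)$ be the Gamma density and put $$f(x)=\int_{\mathbb{R}} g_{\alpha^+,\lambda^+}(x+y)\,g_{\alpha^-,\lambda^-}(y)\,dy,\qquad x\in\mathbb{R},$$ with $f(0):=0$ if the integral diverges at $x=0$ (which happens exactly when $\alpha^++\alpha^-\le 1$). Then $f$ is a Lebesgue density of the bilateral Gamma distribution, and 1. $f\in C^N(\mathbb{R}\setminus\{0\})$; 2. if $N\ge 1$, then $f\in C^{N-1}(\mathbb{R})$; 3. $f\notin C^N(\mathbb{R})$; moreover, no version of the density (no nonnegative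 measurable function that is a Lebesgue density of the distribution) belongs to $C^N(\mathbb{R})$. -/

import Mathlib

open MeasureTheory ProbabilityTheory

noncomputable section

/-- The bilateral Gamma distribution: the law of `X - Y`, where `X` and `Y` are independent,
`X` is Gamma distributed with shape `ap` and rate `lp`, and `Y` is Gamma distributed with
shape `am` and rate `lm`. -/
def bilateralGammaMeasure (ap lp am lm : ℝ) : Measure ℝ :=
  Measure.map (fun p : ℝ × ℝ => p.1 - p.2) ((gammaMeasure ap lp).prod (gammaMeasure am lm))

/-- `g` is a (version of the) Lebesgue density of the bilateral Gamma distribution. -/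
def IsBilateralGammaDensity (ap lp am lm : ℝ) (g : ℝ → ℝ) : Prop :=
  Measurable g ∧ (∀ x, 0 ≤ g x) ∧
    bilateralGammaMeasure ap lp am lm = volume.withDensity (fun x => ENNReal.ofReal (g x))

/-- The bilateral Gamma density, as the convolution of the density of `X` with the density of
`-Y`. The integral converges for all real `x`, except for `x = 0` when `ap + am ≤ 1`, where
the density has a pole. -/
def bilateralGammaPDF (ap lp am lm : ℝ) (x : ℝ) : ℝ :=
  ∫ y, gammaPDFReal ap lp (x + y) * gammaPDFReal am lm y

end

/-!
Write `g_a` for the Gamma density of shape `a` and rate `r`, and `f_{a,b}` for the bilateral Gamma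
density with shapes `a`, `b` and rates `r`, `s`. The identities `g_{a+1}' = r (g_a - g_{a+1})` and
`x g_a = (a / r) g_{a+1}` integrate to `f_{a+1,b}' = r (f_{a,b} - f_{a+1,b})` and
`x f_{a,b} = (a / r) f_{a+1,b} - (b / s) f_{a,b+1}`, and `x ↦ -x` exchanges the two shape-rate
pairs. The second identity gives smoothness away from `0` and the first raises the regularity at
`0` by one with each shape, so everything reduces to `a, b ≤ 1`. There, if `a + b ≤ 1`, a
continuous version is impossible by Fatou's lemma, since `g_a g_b` is not integrable. If
`1 < a + b`, then `f_{a,b}` is continuous and `f_{a,b}(x) ≤ e^{-r x} f_{a,b}(0)` for `x > 0`; were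
`f_{a,b}` differentiable at `0`, its derivative there would be negative, and positive by symmetry.
-/

open Set Filter Topology

section Analysis

lemma integrableOn_rpow_mul_exp_neg_mul_Ioi_iff {p r : ℝ} (hr : 0 < r) :
    IntegrableOn (fun y : ℝ => y ^ p * Real.exp (-(r * y))) (Ioi 0) ↔ -1 < p := by
  refine ⟨fun h => ?_, fun hp => ?_⟩
  · rw [← intervalIntegral.integrableOn_Ioo_rpow_iff one_pos]
    have hexp : ContinuousOn (fun y : ℝ => Real.exp (r * y)) (Icc 0 1) := by fun_prop
    refine ((h.mono_set Ioo_subset_Ioi_self).mul_continuousOn_of_subset hexp measurableSet_Ioo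
      isCompact_Icc Ioo_subset_Icc_self).congr_fun (fun y _ => ?_) measurableSet_Ioo
    beta_reduce
    rw [mul_assoc, ← Real.exp_add, neg_add_cancel, Real.exp_zero, mul_one]
  · simpa only [Real.rpow_one, neg_mul] using integrableOn_rpow_mul_exp_neg_mul_rpow hp one_pos hr

lemma exists_norm_le_of_integral_eq_sub {E : Type*} [NormedAddCommGroup E] [NormedSpace ℝ E]
    {u U : ℝ → E} (hu : Integrable u) (hU : ∀ p q, ∫ z in p..q, u z = U q - U p) :
    ∃ C, ∀ x, ‖U x‖ ≤ C := by
  refine ⟨‖U 0‖ + ∫ z, ‖u z‖, fun x => ?_⟩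
  have h_int : ‖∫ z in 0..x, u z‖ ≤ ∫ z, ‖u z‖ :=
    intervalIntegral.norm_integral_le_integral_norm_uIoc.trans
      (setIntegral_le_integral hu.norm (ae_of_all _ fun z => norm_nonneg (u z)))
  calc ‖U x‖ = ‖U 0 + ∫ z in 0..x, u z‖ := by rw [hU, add_sub_cancel]
    _ ≤ ‖U 0‖ + ‖∫ z in 0..x, u z‖ := norm_add_le _ _
    _ ≤ ‖U 0‖ + ∫ z, ‖u z‖ := by gcongr

lemma le_of_hasDerivWithinAt_of_le_right {f g : ℝ → ℝ} {f' g' x : ℝ}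
    (hf : HasDerivWithinAt f f' (Ioi x) x) (hg : HasDerivWithinAt g g' (Ioi x) x)
    (hx : f x = g x) (hle : ∀ᶠ y in 𝓝[>] x, f y ≤ g y) : f' ≤ g' := by
  rw [hasDerivWithinAt_iff_tendsto_slope' self_notMem_Ioi] at hf hg
  refine le_of_tendsto_of_tendsto hf hg ?_
  filter_upwards [hle, self_mem_nhdsWithin] with y hy hxy
  have hxy' : 0 < y - x := sub_pos.2 hxy
  rw [slope_def_field, slope_def_field, hx]
  gcongr

end Analysis

section Difference

variable {G : Type*} [AddGroup G] [MeasurableSpace G] [MeasurableAdd₂ G]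
  {μ : Measure G} [SFinite μ] [μ.IsAddRightInvariant]

lemma map_sub_prod_withDensity [MeasurableSub₂ G] {f g : G → ENNReal}
    (hf : Measurable f) (hg : Measurable g) :
    ((μ.withDensity f).prod (μ.withDensity g)).map (fun p => p.1 - p.2) =
      μ.withDensity fun x => ∫⁻ y, f (x + y) * g y ∂μ := by
  refine Measure.ext_of_lintegral _ fun φ hφ => ?_
  rw [lintegral_map hφ measurable_sub, prod_withDensity hf hg,
    lintegral_withDensity_eq_lintegral_mul _ (by fun_prop) (by fun_prop),
    lintegral_withDensity_eq_lintegral_mul _ (by fun_prop) hφ, lintegral_prod_symm _ (by fun_prop)]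
  calc ∫⁻ y, ∫⁻ x, f x * g y * φ (x - y) ∂μ ∂μ
      = ∫⁻ y, ∫⁻ x, f (x + y) * g y * φ x ∂μ ∂μ := by
        refine lintegral_congr fun y => ?_
        rw [← lintegral_add_right_eq_self _ y]
        simp only [add_sub_cancel_right]
    _ = ∫⁻ x, ∫⁻ y, f (x + y) * g y * φ x ∂μ ∂μ := lintegral_lintegral_swap (by fun_prop)
    _ = ∫⁻ x, (∫⁻ y, f (x + y) * g y ∂μ) * φ x ∂μ :=
        lintegral_congr fun x => lintegral_mul_const _ (by fun_prop)

lemma integrable_prod_add_mul {u v : G → ℝ} (hu : Integrable u μ) (hv : Integrable v μ) :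
    Integrable (fun p : G × G => u (p.1 + p.2) * v p.2) (μ.prod μ) :=
  (measurePreserving_add_prod μ μ).integrable_comp_of_integrable (hu.mul_prod hv)

lemma intervalIntegral_integral_add_mul {u v U : ℝ → ℝ} (hu : Integrable u) (hv : Integrable v)
    (hU : ∀ p q, ∫ z in p..q, u z = U q - U p) (hUv : ∀ x, Integrable fun y => U (x + y) * v y)
    (p q : ℝ) :
    ∫ x in p..q, ∫ y, u (x + y) * v y = (∫ y, U (q + y) * v y) - ∫ y, U (p + y) * v y := by
  rw [intervalIntegral_integral_swap ((integrable_prod_add_mul hu hv).mono_measure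
    (Measure.prod_mono Measure.restrict_le_self le_rfl)), ← integral_sub (hUv q) (hUv p)]
  refine integral_congr_ae (ae_of_all _ fun y => ?_)
  simp only [intervalIntegral.integral_mul_const]
  rw [intervalIntegral.integral_comp_add_right, hU, sub_mul]

end Difference

section Gamma

variable {a r b s x y : ℝ}

lemma gammaPDFReal_of_nonneg (hx : 0 ≤ x) :
    gammaPDFReal a r x = r ^ a / Real.Gamma a * x ^ (a - 1) * Real.exp (-(r * x)) :=
  if_pos hx

lemma gammaPDFReal_of_neg (hx : x < 0) : gammaPDFReal a r x = 0 :=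
  if_neg hx.not_ge

lemma integrable_gammaPDFReal (ha : 0 < a) (hr : 0 < r) : Integrable (gammaPDFReal a r) := by
  refine ⟨(measurable_gammaPDFReal a r).aestronglyMeasurable, ?_⟩
  rw [hasFiniteIntegral_iff_ofReal (ae_of_all _ (gammaPDFReal_nonneg ha hr))]
  exact (lintegral_gammaPDF_eq_one ha hr).trans_lt ENNReal.one_lt_top

lemma mul_gammaPDFReal (ha : 0 < a) (hr : 0 < r) (x : ℝ) :
    x * gammaPDFReal a r x = a / r * gammaPDFReal (a + 1) r x := by
  rcases lt_or_ge x 0 with hx | hx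
  · simp only [gammaPDFReal_of_neg hx, mul_zero]
  · have hpow : x ^ a = x ^ (a - 1) * x := by
      rw [← Real.rpow_add_one' hx (by linarith), sub_add_cancel]
    rw [gammaPDFReal_of_nonneg hx, gammaPDFReal_of_nonneg hx, Real.Gamma_add_one ha.ne',
      Real.rpow_add_one hr.ne', add_sub_cancel_right, hpow]
    have := (Real.Gamma_pos_of_pos ha).ne'
    field_simp

lemma hasDerivAt_gammaPDFReal_add_one (ha : 0 < a) (hr : 0 < r) (hx : x ≠ 0) :
    HasDerivAt (gammaPDFReal (a + 1) r)
      (r * (gammaPDFReal a r x - gammaPDFReal (a + 1) r x)) x := by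
  rcases lt_or_gt_of_ne hx with hx' | hx'
  · rw [gammaPDFReal_of_neg hx', gammaPDFReal_of_neg hx', sub_zero, mul_zero]
    refine (hasDerivAt_const x (0 : ℝ)).congr_of_eventuallyEq ?_
    filter_upwards [Iio_mem_nhds hx'] with y hy using gammaPDFReal_of_neg hy
  · have h_formula : HasDerivAt
        (fun y : ℝ => r ^ (a + 1) / Real.Gamma (a + 1) * y ^ a * Real.exp (-(r * y)))
        (r ^ (a + 1) / Real.Gamma (a + 1) * (a * x ^ (a - 1)) * Real.exp (-(r * x)) +
          r ^ (a + 1) / Real.Gamma (a + 1) * x ^ a * (Real.exp (-(r * x)) * (-(r * 1)))) x :=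
      ((Real.hasDerivAt_rpow_const (Or.inl hx)).const_mul _).mul
        (((hasDerivAt_id x).const_mul r).neg.exp)
    have h_eq : gammaPDFReal (a + 1) r =ᶠ[𝓝 x]
        fun y => r ^ (a + 1) / Real.Gamma (a + 1) * y ^ a * Real.exp (-(r * y)) := by
      filter_upwards [Ioi_mem_nhds hx'] with y hy
      rw [gammaPDFReal_of_nonneg (le_of_lt hy), add_sub_cancel_right]
    refine (h_formula.congr_of_eventuallyEq h_eq).congr_deriv ?_
    rw [gammaPDFReal_of_nonneg hx'.le, gammaPDFReal_of_nonneg hx'.le, add_sub_cancel_right,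
      Real.Gamma_add_one ha.ne', Real.rpow_add_one hr.ne']
    have := (Real.Gamma_pos_of_pos ha).ne'
    field_simp
    ring

lemma continuous_gammaPDFReal_add_one (ha : 0 < a) : Continuous (gammaPDFReal (a + 1) r) := by
  have hpow : Continuous fun x : ℝ => x ^ (a + 1 - 1) :=
    Real.continuous_rpow_const (by linarith)
  refine Continuous.if_le (by fun_prop) continuous_const continuous_const continuous_id ?_
  rintro x rfl
  rw [add_sub_cancel_right, Real.zero_rpow ha.ne', mul_zero, zero_mul]

lemma integral_gammaPDFReal_sub (ha : 0 < a) (hr : 0 < r) (p q : ℝ) :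
    ∫ z in p..q, r * (gammaPDFReal a r z - gammaPDFReal (a + 1) r z) =
      gammaPDFReal (a + 1) r q - gammaPDFReal (a + 1) r p :=
  integral_eq_of_hasDerivAt_off_countable (s := {0}) _ _ (countable_singleton _)
    (continuous_gammaPDFReal_add_one ha).continuousOn
    (fun _ hx => hasDerivAt_gammaPDFReal_add_one ha hr hx.2)
    (((integrable_gammaPDFReal ha hr).sub
      (integrable_gammaPDFReal (by positivity) hr)).const_mul r).intervalIntegrable

lemma exists_norm_gammaPDFReal_add_one_le (ha : 0 < a) (hr : 0 < r) :
    ∃ C, ∀ x, ‖gammaPDFReal (a + 1) r x‖ ≤ C :=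
  exists_norm_le_of_integral_eq_sub (((integrable_gammaPDFReal ha hr).sub
    (integrable_gammaPDFReal (by positivity) hr)).const_mul r) (integral_gammaPDFReal_sub ha hr)

lemma continuousAt_gammaPDFReal (ha : 0 < a) (hr : 0 < r) (hx : x ≠ 0) :
    ContinuousAt (gammaPDFReal a r) x := by
  have h : ContinuousAt (fun y => y⁻¹ * (a / r * gammaPDFReal (a + 1) r y)) x :=
    (continuousAt_inv₀ hx).mul
      ((continuous_gammaPDFReal_add_one ha).continuousAt.const_mul (a / r))
  refine h.congr ?_
  filter_upwards [isOpen_ne.mem_nhds hx] with y hy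
  rw [← mul_gammaPDFReal ha hr, inv_mul_cancel_left₀ hy]

lemma gammaPDFReal_add_le (ha : 0 < a) (hr : 0 < r) (ha1 : a ≤ 1) (hx : 0 ≤ x) (hy : 0 < y) :
    gammaPDFReal a r (x + y) ≤ Real.exp (-(r * x)) * gammaPDFReal a r y := by
  have hpow : (x + y) ^ (a - 1) ≤ y ^ (a - 1) :=
    Real.rpow_le_rpow_of_nonpos hy (by linarith) (by linarith)
  have := Real.Gamma_pos_of_pos ha
  rw [gammaPDFReal_of_nonneg (by positivity), gammaPDFReal_of_nonneg hy.le]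
  calc r ^ a / Real.Gamma a * (x + y) ^ (a - 1) * Real.exp (-(r * (x + y)))
      ≤ r ^ a / Real.Gamma a * y ^ (a - 1) * Real.exp (-(r * (x + y))) := by gcongr
    _ = Real.exp (-(r * x)) * (r ^ a / Real.Gamma a * y ^ (a - 1) * Real.exp (-(r * y))) := by
      rw [mul_add, neg_add, Real.exp_add]
      ring

lemma gammaPDFReal_mul_gammaPDFReal (hy : 0 < y) :
    gammaPDFReal a r y * gammaPDFReal b s y =
      r ^ a / Real.Gamma a * (s ^ b / Real.Gamma b) *
        (y ^ (a + b - 2) * Real.exp (-((r + s) * y))) := by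
  have hpow : y ^ (a + b - 2) = y ^ (a - 1) * y ^ (b - 1) := by
    rw [← Real.rpow_add hy]
    ring_nf
  rw [gammaPDFReal_of_nonneg hy.le, gammaPDFReal_of_nonneg hy.le, hpow, add_mul, neg_add,
    Real.exp_add]
  ring

lemma integrable_gammaPDFReal_mul_gammaPDFReal_iff (ha : 0 < a) (hr : 0 < r) (hb : 0 < b)
    (hs : 0 < s) :
    Integrable (fun y => gammaPDFReal a r y * gammaPDFReal b s y) ↔ 1 < a + b := by
  have h_support : Function.support (fun y => gammaPDFReal a r y * gammaPDFReal b s y) ⊆ Ici 0 :=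
    fun y hy => mem_Ici.2 <| not_lt.1 fun hy' =>
      hy (by simp only [gammaPDFReal_of_neg hy', mul_zero])
  have hc : IsUnit (r ^ a / Real.Gamma a * (s ^ b / Real.Gamma b)) := by
    have := Real.Gamma_pos_of_pos ha
    have := Real.Gamma_pos_of_pos hb
    exact IsUnit.mk0 _ (by positivity)
  have h_eq : EqOn (fun y => gammaPDFReal a r y * gammaPDFReal b s y)
      (fun y => r ^ a / Real.Gamma a * (s ^ b / Real.Gamma b) *
        (y ^ (a + b - 2) * Real.exp (-((r + s) * y)))) (Ioi 0) :=
    fun _ hy => gammaPDFReal_mul_gammaPDFReal hy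
  rw [← integrableOn_iff_integrable_of_support_subset h_support,
    integrableOn_Ici_iff_integrableOn_Ioi, integrableOn_congr_fun h_eq measurableSet_Ioi,
    IntegrableOn, integrable_const_mul_iff hc, ← IntegrableOn,
    integrableOn_rpow_mul_exp_neg_mul_Ioi_iff (by positivity)]
  constructor <;> intro h <;> linarith

end Gamma

section BilateralGamma

variable {a r b s x : ℝ}

lemma bilateralGammaPDF_neg (a r b s x : ℝ) :
    bilateralGammaPDF a r b s (-x) = bilateralGammaPDF b s a r x := by
  unfold bilateralGammaPDF
  rw [← integral_add_right_eq_self _ x]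
  refine integral_congr_ae (ae_of_all _ fun y => ?_)
  simp only [add_comm y x, neg_add_cancel_left, mul_comm]

lemma bilateralGammaPDF_comp_neg (a r b s : ℝ) :
    bilateralGammaPDF a r b s ∘ Neg.neg = bilateralGammaPDF b s a r :=
  funext (bilateralGammaPDF_neg a r b s)

lemma gammaPDFReal_add_mul_nonneg (ha : 0 < a) (hr : 0 < r) (hb : 0 < b) (hs : 0 < s) (x y : ℝ) :
    0 ≤ gammaPDFReal a r (x + y) * gammaPDFReal b s y :=
  mul_nonneg (gammaPDFReal_nonneg ha hr _) (gammaPDFReal_nonneg hb hs y)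

lemma bilateralGammaPDF_nonneg (ha : 0 < a) (hr : 0 < r) (hb : 0 < b) (hs : 0 < s) (x : ℝ) :
    0 ≤ bilateralGammaPDF a r b s x :=
  integral_nonneg (gammaPDFReal_add_mul_nonneg ha hr hb hs x)

lemma integrable_gammaPDFReal_add_one_add_mul (ha : 0 < a) (hr : 0 < r) (hb : 0 < b) (hs : 0 < s)
    (x : ℝ) : Integrable fun y => gammaPDFReal (a + 1) r (x + y) * gammaPDFReal b s y := by
  obtain ⟨C, hC⟩ := exists_norm_gammaPDFReal_add_one_le ha hr
  exact (integrable_gammaPDFReal hb hs).bdd_mul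
    (Measurable.aestronglyMeasurable (by fun_prop)) (ae_of_all _ fun y => hC (x + y))

lemma integrable_gammaPDFReal_add_mul_add_one (ha : 0 < a) (hr : 0 < r) (hb : 0 < b) (hs : 0 < s)
    (x : ℝ) : Integrable fun y => gammaPDFReal a r (x + y) * gammaPDFReal (b + 1) s y := by
  obtain ⟨C, hC⟩ := exists_norm_gammaPDFReal_add_one_le hb hs
  exact ((integrable_gammaPDFReal ha hr).comp_add_left x).mul_bdd
    (measurable_gammaPDFReal _ _).aestronglyMeasurable (ae_of_all _ hC)

lemma mul_gammaPDFReal_add_mul (ha : 0 < a) (hr : 0 < r) (hb : 0 < b) (hs : 0 < s) (x y : ℝ) :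
    x * (gammaPDFReal a r (x + y) * gammaPDFReal b s y) =
      a / r * (gammaPDFReal (a + 1) r (x + y) * gammaPDFReal b s y) -
        b / s * (gammaPDFReal a r (x + y) * gammaPDFReal (b + 1) s y) := by
  linear_combination gammaPDFReal b s y * mul_gammaPDFReal ha hr (x + y) -
    gammaPDFReal a r (x + y) * mul_gammaPDFReal hb hs y

lemma integrable_gammaPDFReal_add_mul (ha : 0 < a) (hr : 0 < r) (hb : 0 < b) (hs : 0 < s)
    (hx : x ≠ 0) : Integrable fun y => gammaPDFReal a r (x + y) * gammaPDFReal b s y := by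
  rw [← integrable_const_mul_iff (IsUnit.mk0 x hx)]
  simp only [mul_gammaPDFReal_add_mul ha hr hb hs]
  exact ((integrable_gammaPDFReal_add_one_add_mul ha hr hb hs x).const_mul _).sub
    ((integrable_gammaPDFReal_add_mul_add_one ha hr hb hs x).const_mul _)

lemma ofReal_bilateralGammaPDF (ha : 0 < a) (hr : 0 < r) (hb : 0 < b) (hs : 0 < s) (hx : x ≠ 0) :
    ENNReal.ofReal (bilateralGammaPDF a r b s x) =
      ∫⁻ y, ENNReal.ofReal (gammaPDFReal a r (x + y) * gammaPDFReal b s y) :=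
  ofReal_integral_eq_lintegral_ofReal (integrable_gammaPDFReal_add_mul ha hr hb hs hx)
    (ae_of_all _ (gammaPDFReal_add_mul_nonneg ha hr hb hs x))

lemma mul_bilateralGammaPDF (ha : 0 < a) (hr : 0 < r) (hb : 0 < b) (hs : 0 < s) (x : ℝ) :
    x * bilateralGammaPDF a r b s x =
      a / r * bilateralGammaPDF (a + 1) r b s x - b / s * bilateralGammaPDF a r (b + 1) s x := by
  unfold bilateralGammaPDF
  simp only [← integral_const_mul, mul_gammaPDFReal_add_mul ha hr hb hs]
  exact integral_sub ((integrable_gammaPDFReal_add_one_add_mul ha hr hb hs x).const_mul _)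
    ((integrable_gammaPDFReal_add_mul_add_one ha hr hb hs x).const_mul _)

lemma integrable_bilateralGammaPDF (ha : 0 < a) (hr : 0 < r) (hb : 0 < b) (hs : 0 < s) :
    Integrable (bilateralGammaPDF a r b s) :=
  (integrable_prod_add_mul (integrable_gammaPDFReal ha hr)
    (integrable_gammaPDFReal hb hs)).integral_prod_left

lemma integrable_bilateralGammaPDF_sub (ha : 0 < a) (hr : 0 < r) (hb : 0 < b) (hs : 0 < s) :
    Integrable fun x => r * (bilateralGammaPDF a r b s x - bilateralGammaPDF (a + 1) r b s x) :=
  ((integrable_bilateralGammaPDF ha hr hb hs).sub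
    (integrable_bilateralGammaPDF (by positivity) hr hb hs)).const_mul r

lemma integral_bilateralGammaPDF_sub (ha : 0 < a) (hr : 0 < r) (hb : 0 < b) (hs : 0 < s)
    (p q : ℝ) :
    ∫ x in p..q, r * (bilateralGammaPDF a r b s x - bilateralGammaPDF (a + 1) r b s x) =
      bilateralGammaPDF (a + 1) r b s q - bilateralGammaPDF (a + 1) r b s p := by
  refine Eq.trans ?_ (intervalIntegral_integral_add_mul (((integrable_gammaPDFReal ha hr).sub
    (integrable_gammaPDFReal (by positivity) hr)).const_mul r) (integrable_gammaPDFReal hb hs)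
    (integral_gammaPDFReal_sub ha hr) (integrable_gammaPDFReal_add_one_add_mul ha hr hb hs) p q)
  refine intervalIntegral.integral_congr_ae ?_
  filter_upwards [Measure.ae_ne volume (0 : ℝ)] with x hx _
  unfold bilateralGammaPDF
  rw [← integral_sub (integrable_gammaPDFReal_add_mul ha hr hb hs hx)
    (integrable_gammaPDFReal_add_one_add_mul ha hr hb hs x), ← integral_const_mul]
  refine integral_congr_ae (ae_of_all _ fun y => ?_)
  simp only [Pi.sub_apply]
  ring

lemma continuous_bilateralGammaPDF_add_one (ha : 0 < a) (hr : 0 < r) (hb : 0 < b) (hs : 0 < s) :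
    Continuous (bilateralGammaPDF (a + 1) r b s) := by
  refine (((integrable_bilateralGammaPDF_sub ha hr hb hs).continuous_primitive 0).add_const
    (bilateralGammaPDF (a + 1) r b s 0)).congr fun x => ?_
  rw [integral_bilateralGammaPDF_sub ha hr hb hs, sub_add_cancel]

lemma hasDerivAt_bilateralGammaPDF_add_one (ha : 0 < a) (hr : 0 < r) (hb : 0 < b) (hs : 0 < s)
    (hx : ContinuousAt (bilateralGammaPDF a r b s) x) :
    HasDerivAt (bilateralGammaPDF (a + 1) r b s)
      (r * (bilateralGammaPDF a r b s x - bilateralGammaPDF (a + 1) r b s x)) x := by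
  have h_int := integrable_bilateralGammaPDF_sub ha hr hb hs
  have h_primitive := intervalIntegral.integral_hasDerivAt_right (a := 0) h_int.intervalIntegrable
    h_int.aestronglyMeasurable.stronglyMeasurableAtFilter
    ((hx.sub (continuous_bilateralGammaPDF_add_one ha hr hb hs).continuousAt).const_mul r)
  refine (h_primitive.add_const (bilateralGammaPDF (a + 1) r b s 0)).congr_of_eventuallyEq
    (Eventually.of_forall fun v => ?_)
  simp only [integral_bilateralGammaPDF_sub ha hr hb hs, sub_add_cancel]

lemma contDiffOn_succ_bilateralGammaPDF_add_one {n : ℕ} {U : Set ℝ} (hU : IsOpen U) (ha : 0 < a)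
    (hr : 0 < r) (hb : 0 < b) (hs : 0 < s) (h : ContDiffOn ℝ n (bilateralGammaPDF a r b s) U)
    (h_add_one : ContDiffOn ℝ n (bilateralGammaPDF (a + 1) r b s) U) :
    ContDiffOn ℝ (n + 1) (bilateralGammaPDF (a + 1) r b s) U := by
  have h_deriv (x : ℝ) (hx : x ∈ U) : HasDerivAt (bilateralGammaPDF (a + 1) r b s)
      (r * (bilateralGammaPDF a r b s x - bilateralGammaPDF (a + 1) r b s x)) x :=
    hasDerivAt_bilateralGammaPDF_add_one ha hr hb hs
      (h.continuousOn.continuousAt (hU.mem_nhds hx))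
  exact (contDiffOn_succ_iff_deriv_of_isOpen hU).2
    ⟨fun x hx => (h_deriv x hx).differentiableAt.differentiableWithinAt, by simp,
      (contDiffOn_const.mul (h.sub h_add_one)).congr fun x hx => (h_deriv x hx).deriv⟩

lemma contDiffOn_bilateralGammaPDF_of_add_one {n : ℕ} (ha : 0 < a) (hr : 0 < r) (hb : 0 < b)
    (hs : 0 < s) (h_left : ContDiffOn ℝ n (bilateralGammaPDF (a + 1) r b s) {x | x ≠ 0})
    (h_right : ContDiffOn ℝ n (bilateralGammaPDF (b + 1) s a r) {x | x ≠ 0}) :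
    ContDiffOn ℝ n (bilateralGammaPDF a r b s) {x | x ≠ 0} := by
  have h_right' : ContDiffOn ℝ n (bilateralGammaPDF a r (b + 1) s) {x | x ≠ 0} := by
    rw [← bilateralGammaPDF_comp_neg]
    exact h_right.comp contDiff_neg.contDiffOn fun x hx => neg_ne_zero.2 hx
  have h_inv : ContDiffOn ℝ n (fun x : ℝ => x⁻¹) {x | x ≠ 0} := contDiffOn_id.inv fun _ hx => hx
  refine (h_inv.mul ((contDiffOn_const (c := a / r).mul h_left).sub
    (contDiffOn_const (c := b / s).mul h_right'))).congr fun x hx => ?_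
  rw [← mul_bilateralGammaPDF ha hr hb hs, inv_mul_cancel_left₀ hx]

lemma contDiffOn_bilateralGammaPDF (n : ℕ) (ha : 0 < a) (hr : 0 < r) (hb : 0 < b) (hs : 0 < s) :
    ContDiffOn ℝ n (bilateralGammaPDF a r b s) {x | x ≠ 0} := by
  induction n generalizing a r b s with
  | zero =>
    exact contDiffOn_bilateralGammaPDF_of_add_one ha hr hb hs
      (contDiffOn_zero.2 (continuous_bilateralGammaPDF_add_one ha hr hb hs).continuousOn)
      (contDiffOn_zero.2 (continuous_bilateralGammaPDF_add_one hb hs ha hr).continuousOn)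
  | succ n ih =>
    exact contDiffOn_bilateralGammaPDF_of_add_one ha hr hb hs
      (contDiffOn_succ_bilateralGammaPDF_add_one isOpen_ne ha hr hb hs (ih ha hr hb hs)
        (ih (by positivity) hr hb hs))
      (contDiffOn_succ_bilateralGammaPDF_add_one isOpen_ne hb hs ha hr (ih hb hs ha hr)
        (ih (by positivity) hs ha hr))

lemma continuousAt_bilateralGammaPDF (ha : 0 < a) (hr : 0 < r) (hb : 0 < b) (hs : 0 < s)
    (hx : x ≠ 0) : ContinuousAt (bilateralGammaPDF a r b s) x :=
  (contDiffOn_bilateralGammaPDF 0 ha hr hb hs).continuousOn.continuousAt (isOpen_ne.mem_nhds hx)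

lemma ae_gammaPDFReal_add_mul_le (ha : 0 < a) (hr : 0 < r) (hb : 0 < b) (hs : 0 < s)
    (ha1 : a ≤ 1) (hx : 0 ≤ x) :
    ∀ᵐ y, gammaPDFReal a r (x + y) * gammaPDFReal b s y ≤
      Real.exp (-(r * x)) * (gammaPDFReal a r y * gammaPDFReal b s y) := by
  filter_upwards [Measure.ae_ne volume (0 : ℝ)] with y hy
  rcases lt_or_gt_of_ne hy with hy' | hy'
  · simp only [gammaPDFReal_of_neg hy', mul_zero, le_refl]
  · rw [← mul_assoc]
    exact mul_le_mul_of_nonneg_right (gammaPDFReal_add_le ha hr ha1 hx hy')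
      (gammaPDFReal_nonneg hb hs y)

lemma ae_tendsto_gammaPDFReal_add_mul_zero (ha : 0 < a) (hr : 0 < r) (b s : ℝ) :
    ∀ᵐ y, Tendsto (fun x => gammaPDFReal a r (x + y) * gammaPDFReal b s y) (𝓝 0)
      (𝓝 (gammaPDFReal a r y * gammaPDFReal b s y)) := by
  filter_upwards [Measure.ae_ne volume (0 : ℝ)] with y hy
  have h_add : Tendsto (fun x => x + y) (𝓝 0) (𝓝 y) := by
    simpa only [zero_add] using (continuous_add_const y).tendsto 0
  exact ((continuousAt_gammaPDFReal ha hr hy).tendsto.comp h_add).mul_const _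

lemma continuousWithinAt_bilateralGammaPDF_zero (ha : 0 < a) (hr : 0 < r) (hb : 0 < b)
    (hs : 0 < s) (ha1 : a ≤ 1) (hab : 1 < a + b) :
    ContinuousWithinAt (bilateralGammaPDF a r b s) (Ici 0) 0 := by
  refine continuousWithinAt_of_dominated
    (Eventually.of_forall fun x => Measurable.aestronglyMeasurable (by fun_prop)) ?_
    ((integrable_gammaPDFReal_mul_gammaPDFReal_iff ha hr hb hs).2 hab) ?_
  · filter_upwards [self_mem_nhdsWithin] with x hx
    filter_upwards [ae_gammaPDFReal_add_mul_le ha hr hb hs ha1 hx] with y hy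
    rw [Real.norm_of_nonneg (gammaPDFReal_add_mul_nonneg ha hr hb hs x y)]
    exact hy.trans (mul_le_of_le_one_left
      (mul_nonneg (gammaPDFReal_nonneg ha hr y) (gammaPDFReal_nonneg hb hs y))
      (Real.exp_le_one_iff.2 (neg_nonpos.2 (mul_nonneg hr.le hx))))
  · filter_upwards [ae_tendsto_gammaPDFReal_add_mul_zero ha hr b s] with y hy
    simpa only [ContinuousWithinAt, zero_add] using hy.mono_left nhdsWithin_le_nhds

lemma continuous_bilateralGammaPDF_of_le_one (ha : 0 < a) (hr : 0 < r) (hb : 0 < b) (hs : 0 < s)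
    (ha1 : a ≤ 1) (hb1 : b ≤ 1) (hab : 1 < a + b) : Continuous (bilateralGammaPDF a r b s) := by
  refine continuous_iff_continuousAt.2 fun x => ?_
  rcases eq_or_ne x 0 with rfl | hx
  · have h_right := continuousWithinAt_bilateralGammaPDF_zero ha hr hb hs ha1 hab
    have h_left := continuousWithinAt_bilateralGammaPDF_zero hb hs ha hr hb1 (by linarith)
    rw [← neg_zero] at h_left
    have h_left' := h_left.comp continuousWithinAt_neg (s := Iic 0) fun x hx => by
      simpa using hx
    rw [bilateralGammaPDF_comp_neg] at h_left'
    exact continuousAt_iff_continuous_left_right.2 ⟨h_left', h_right⟩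
  · exact continuousAt_bilateralGammaPDF ha hr hb hs hx

lemma continuous_bilateralGammaPDF (ha : 0 < a) (hr : 0 < r) (hb : 0 < b) (hs : 0 < s)
    (hab : 1 < a + b) : Continuous (bilateralGammaPDF a r b s) := by
  rcases lt_or_ge 1 a with ha1 | ha1
  · simpa only [sub_add_cancel] using
      continuous_bilateralGammaPDF_add_one (sub_pos.2 ha1) hr hb hs
  rcases lt_or_ge 1 b with hb1 | hb1
  · rw [← bilateralGammaPDF_comp_neg]
    refine Continuous.comp ?_ continuous_neg
    simpa only [sub_add_cancel] using
      continuous_bilateralGammaPDF_add_one (sub_pos.2 hb1) hs ha hr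
  · exact continuous_bilateralGammaPDF_of_le_one ha hr hb hs ha1 hb1 hab

lemma contDiff_bilateralGammaPDF (n : ℕ) (ha : 0 < a) (hr : 0 < r) (hb : 0 < b) (hs : 0 < s)
    (hn : n + 1 < a + b) : ContDiff ℝ n (bilateralGammaPDF a r b s) := by
  induction n generalizing a r b s with
  | zero =>
    exact contDiff_zero.2 (continuous_bilateralGammaPDF ha hr hb hs (by simpa using hn))
  | succ n ih =>
    have h_step {a r b s : ℝ} (ha : 1 < a) (hr : 0 < r) (hb : 0 < b) (hs : 0 < s)
        (hn : ((n + 1 : ℕ) : ℝ) + 1 < a + b) :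
        ContDiff ℝ (n + 1 : ℕ) (bilateralGammaPDF a r b s) := by
      obtain ⟨a, rfl⟩ : ∃ a', a = a' + 1 := ⟨a - 1, by ring⟩
      push_cast at hn ⊢
      exact contDiffOn_univ.1 <| contDiffOn_succ_bilateralGammaPDF_add_one isOpen_univ
        (by linarith) hr hb hs (ih (by linarith) hr hb hs (by linarith)).contDiffOn
        (ih (by linarith) hr hb hs (by linarith)).contDiffOn
    rcases lt_or_ge 1 a with ha1 | ha1
    · exact h_step ha1 hr hb hs hn
    · rw [← bilateralGammaPDF_comp_neg]
      refine (h_step ?_ hs ha hr (by linarith)).comp contDiff_neg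
      push_cast at hn
      linarith [n.cast_nonneg (α := ℝ)]

lemma one_lt_add_of_eqOn_bilateralGammaPDF (ha : 0 < a) (hr : 0 < r) (hb : 0 < b) (hs : 0 < s)
    {g : ℝ → ℝ} (hg : EqOn g (bilateralGammaPDF a r b s) {x | x ≠ 0}) (hg0 : ContinuousAt g 0) :
    1 < a + b := by
  rw [← integrable_gammaPDFReal_mul_gammaPDFReal_iff ha hr hb hs]
  obtain ⟨x, hx_ne, hx_lim⟩ : ∃ x : ℕ → ℝ, (∀ n, x n ≠ 0) ∧ Tendsto x atTop (𝓝 0) :=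
    ⟨_, fun _ => Nat.one_div_pos_of_nat.ne', tendsto_one_div_add_atTop_nhds_zero_nat⟩
  have h_lintegral (n : ℕ) : ∫⁻ y, ‖gammaPDFReal a r (x n + y) * gammaPDFReal b s y‖ₑ =
      ENNReal.ofReal (g (x n)) := by
    rw [hg (hx_ne n), ofReal_bilateralGammaPDF ha hr hb hs (hx_ne n)]
    exact lintegral_congr fun y =>
      Real.enorm_of_nonneg (gammaPDFReal_add_mul_nonneg ha hr hb hs (x n) y)
  refine integrable_of_tendsto (G := fun n y => gammaPDFReal a r (x n + y) * gammaPDFReal b s y)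
    ?_ (fun n => Measurable.aestronglyMeasurable (by fun_prop)) ?_
  · filter_upwards [ae_tendsto_gammaPDFReal_add_mul_zero ha hr b s] with y hy
      using hy.comp hx_lim
  · simp only [h_lintegral]
    have h_lim : Tendsto (fun n => ENNReal.ofReal (g (x n))) atTop (𝓝 (ENNReal.ofReal (g 0))) :=
      ENNReal.tendsto_ofReal (hg0.tendsto.comp hx_lim)
    rw [h_lim.liminf_eq]
    exact ENNReal.ofReal_ne_top

lemma bilateralGammaPDF_zero_pos (ha : 0 < a) (hr : 0 < r) (hb : 0 < b) (hs : 0 < s)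
    (hab : 1 < a + b) : 0 < bilateralGammaPDF a r b s 0 := by
  unfold bilateralGammaPDF
  simp only [zero_add]
  rw [integral_pos_iff_support_of_nonneg
    (fun y => mul_nonneg (gammaPDFReal_nonneg ha hr y) (gammaPDFReal_nonneg hb hs y))
    ((integrable_gammaPDFReal_mul_gammaPDFReal_iff ha hr hb hs).2 hab)]
  have h_support : Ioi 0 ⊆ Function.support fun y => gammaPDFReal a r y * gammaPDFReal b s y :=
    fun y hy => (mul_pos (gammaPDFReal_pos ha hr hy) (gammaPDFReal_pos hb hs hy)).ne'
  exact lt_of_lt_of_le (by simp) (measure_mono h_support)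

lemma bilateralGammaPDF_le_exp_mul (ha : 0 < a) (hr : 0 < r) (hb : 0 < b) (hs : 0 < s)
    (ha1 : a ≤ 1) (hab : 1 < a + b) (hx : 0 < x) :
    bilateralGammaPDF a r b s x ≤ Real.exp (-(r * x)) * bilateralGammaPDF a r b s 0 := by
  unfold bilateralGammaPDF
  simp only [zero_add]
  rw [← integral_const_mul]
  exact integral_mono_ae (integrable_gammaPDFReal_add_mul ha hr hb hs hx.ne')
    (((integrable_gammaPDFReal_mul_gammaPDFReal_iff ha hr hb hs).2 hab).const_mul _)
    (ae_gammaPDFReal_add_mul_le ha hr hb hs ha1 hx.le)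

lemma deriv_bilateralGammaPDF_zero_neg (ha : 0 < a) (hr : 0 < r) (hb : 0 < b) (hs : 0 < s)
    (ha1 : a ≤ 1) (hab : 1 < a + b)
    (hd : DifferentiableAt ℝ (bilateralGammaPDF a r b s) 0) :
    deriv (bilateralGammaPDF a r b s) 0 < 0 := by
  have h_exp : HasDerivAt (fun x => Real.exp (-(r * x)) * bilateralGammaPDF a r b s 0)
      (Real.exp (-(r * 0)) * (-(r * 1)) * bilateralGammaPDF a r b s 0) 0 :=
    (((hasDerivAt_id (0 : ℝ)).const_mul r).neg.exp).mul_const _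
  have h_le := le_of_hasDerivWithinAt_of_le_right hd.hasDerivAt.hasDerivWithinAt
    h_exp.hasDerivWithinAt (by simp only [mul_zero, neg_zero, Real.exp_zero, one_mul])
    (by filter_upwards [self_mem_nhdsWithin] with x hx
        using bilateralGammaPDF_le_exp_mul ha hr hb hs ha1 hab hx)
  simp only [mul_zero, neg_zero, Real.exp_zero, one_mul, mul_one, neg_mul] at h_le
  have := mul_pos hr (bilateralGammaPDF_zero_pos ha hr hb hs hab)
  linarith

lemma not_differentiableAt_bilateralGammaPDF_zero (ha : 0 < a) (hr : 0 < r) (hb : 0 < b)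
    (hs : 0 < s) (ha1 : a ≤ 1) (hb1 : b ≤ 1) (hab : 1 < a + b) :
    ¬ DifferentiableAt ℝ (bilateralGammaPDF a r b s) 0 := by
  intro hd
  have h_swap : HasDerivAt (bilateralGammaPDF b s a r)
      (deriv (bilateralGammaPDF a r b s) 0 * -1) 0 := by
    rw [← bilateralGammaPDF_comp_neg]
    exact HasDerivAt.comp 0 (by simpa only [neg_zero] using hd.hasDerivAt) (hasDerivAt_neg 0)
  have h_left := deriv_bilateralGammaPDF_zero_neg hb hs ha hr hb1 (by linarith)
    h_swap.differentiableAt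
  rw [h_swap.deriv] at h_left
  linarith [deriv_bilateralGammaPDF_zero_neg ha hr hb hs ha1 hab hd]

lemma add_deriv_eqOn_bilateralGammaPDF (ha : 0 < a) (hr : 0 < r) (hb : 0 < b) (hs : 0 < s)
    {g : ℝ → ℝ} (hg : EqOn g (bilateralGammaPDF (a + 1) r b s) {x | x ≠ 0}) :
    EqOn (fun x => g x + r⁻¹ * deriv g x) (bilateralGammaPDF a r b s) {x | x ≠ 0} := by
  intro x hx
  have h_deriv : deriv g x =
      r * (bilateralGammaPDF a r b s x - bilateralGammaPDF (a + 1) r b s x) := by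
    rw [(hg.eventuallyEq_of_mem (isOpen_ne.mem_nhds hx)).deriv_eq]
    exact (hasDerivAt_bilateralGammaPDF_add_one ha hr hb hs
      (continuousAt_bilateralGammaPDF ha hr hb hs hx)).deriv
  simp only [h_deriv, hg hx, inv_mul_cancel_left₀ hr.ne', add_sub_cancel]

lemma not_contDiff_one_of_eqOn_bilateralGammaPDF (ha : 0 < a) (hr : 0 < r) (hb : 0 < b)
    (hs : 0 < s) (ha1 : a ≤ 1) (hb1 : b ≤ 1) {g : ℝ → ℝ}
    (hg : EqOn g (bilateralGammaPDF a r b s) {x | x ≠ 0}) : ¬ ContDiff ℝ 1 g := by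
  intro h
  have hab := one_lt_add_of_eqOn_bilateralGammaPDF ha hr hb hs hg h.continuous.continuousAt
  have h_eq : g = bilateralGammaPDF a r b s :=
    Continuous.ext_on (dense_compl_singleton 0) h.continuous
      (continuous_bilateralGammaPDF ha hr hb hs hab) hg
  exact not_differentiableAt_bilateralGammaPDF_zero ha hr hb hs ha1 hb1 hab
    (h_eq ▸ h.differentiable one_ne_zero 0)

lemma not_contDiff_of_eqOn_bilateralGammaPDF (n : ℕ) (ha : 0 < a) (hr : 0 < r) (hb : 0 < b)
    (hs : 0 < s) (hn : a + b ≤ n + 1) {g : ℝ → ℝ}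
    (hg : EqOn g (bilateralGammaPDF a r b s) {x | x ≠ 0}) : ¬ ContDiff ℝ n g := by
  induction n generalizing a r b s g with
  | zero =>
    intro h
    have := one_lt_add_of_eqOn_bilateralGammaPDF ha hr hb hs hg h.continuous.continuousAt
    exact absurd hn (by simpa using this)
  | succ n ih =>
    have h_step {a r b s : ℝ} (ha : 1 < a) (hr : 0 < r) (hb : 0 < b) (hs : 0 < s)
        (hn : a + b ≤ (n + 1 : ℕ) + 1) {g : ℝ → ℝ}
        (hg : EqOn g (bilateralGammaPDF a r b s) {x | x ≠ 0}) : ¬ ContDiff ℝ (n + 1 : ℕ) g := by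
      intro h
      obtain ⟨a, rfl⟩ : ∃ a', a = a' + 1 := ⟨a - 1, by ring⟩
      push_cast at hn h
      exact ih (by linarith) hr hb hs (by linarith)
        (add_deriv_eqOn_bilateralGammaPDF (by linarith) hr hb hs hg)
        ((h.of_le (by exact_mod_cast n.le_succ)).add
          (contDiff_const.mul (contDiff_succ_iff_deriv.1 h).2.2))
    rcases lt_or_ge 1 a with ha1 | ha1
    · exact h_step ha1 hr hb hs hn hg
    rcases lt_or_ge 1 b with hb1 | hb1
    · refine fun h => h_step hb1 hs ha hr (by linarith) (g := g ∘ Neg.neg) (fun x hx => ?_)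
        (h.comp contDiff_neg)
      rw [Function.comp_apply, hg (neg_ne_zero.2 hx), bilateralGammaPDF_neg]
    · exact fun h => not_contDiff_one_of_eqOn_bilateralGammaPDF ha hr hb hs ha1 hb1 hg
        (h.of_le (by exact_mod_cast n.succ_pos))

lemma isBilateralGammaDensity_bilateralGammaPDF (ha : 0 < a) (hr : 0 < r) (hb : 0 < b)
    (hs : 0 < s) : IsBilateralGammaDensity a r b s (bilateralGammaPDF a r b s) := by
  have h_meas : StronglyMeasurable
      fun p : ℝ × ℝ => gammaPDFReal a r (p.1 + p.2) * gammaPDFReal b s p.2 :=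
    Measurable.stronglyMeasurable (by fun_prop)
  refine ⟨h_meas.integral_prod_right'.measurable, bilateralGammaPDF_nonneg ha hr hb hs, ?_⟩
  refine (map_sub_prod_withDensity (measurable_gammaPDFReal a r).ennreal_ofReal
    (measurable_gammaPDFReal b s).ennreal_ofReal).trans (withDensity_congr_ae ?_)
  filter_upwards [Measure.ae_ne volume (0 : ℝ)] with x hx
  simp only [ofReal_bilateralGammaPDF ha hr hb hs hx,
    ENNReal.ofReal_mul (gammaPDFReal_nonneg ha hr _)]

lemma IsBilateralGammaDensity.ae_eq {f g : ℝ → ℝ} (hf : IsBilateralGammaDensity a r b s f)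
    (hg : IsBilateralGammaDensity a r b s g) : f =ᵐ[volume] g := by
  obtain ⟨hfm, hf0, hf⟩ := hf
  obtain ⟨hgm, hg0, hg⟩ := hg
  filter_upwards [(withDensity_eq_iff_of_sigmaFinite hfm.ennreal_ofReal.aemeasurable
    hgm.ennreal_ofReal.aemeasurable).1 (hf.symm.trans hg)] with x hx
  exact (ENNReal.ofReal_eq_ofReal_iff (hf0 x) (hg0 x)).1 hx

lemma IsBilateralGammaDensity.eqOn_bilateralGammaPDF (ha : 0 < a) (hr : 0 < r) (hb : 0 < b)
    (hs : 0 < s) {g : ℝ → ℝ} (hg : IsBilateralGammaDensity a r b s g) (hgc : Continuous g) :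
    EqOn g (bilateralGammaPDF a r b s) {x | x ≠ 0} :=
  Measure.eqOn_open_of_ae_eq
    (ae_restrict_of_ae (hg.ae_eq (isBilateralGammaDensity_bilateralGammaPDF ha hr hb hs)))
    isOpen_ne hgc.continuousOn (contDiffOn_bilateralGammaPDF 0 ha hr hb hs).continuousOn

end BilateralGamma

theorem theorem4p1 (ap lp am lm : ℝ) (hap : 0 < ap) (hlp : 0 < lp) (ham : 0 < am) (hlm : 0 < lm)
    (N : ℕ) (hN₁ : (N : ℝ) < ap + am) (hN₂ : ap + am ≤ (N : ℝ) + 1) :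
    IsBilateralGammaDensity ap lp am lm (bilateralGammaPDF ap lp am lm) ∧
    ContDiffOn ℝ N (bilateralGammaPDF ap lp am lm) {x : ℝ | x ≠ 0} ∧
    (∀ m : ℕ, m + 1 = N → ContDiff ℝ m (bilateralGammaPDF ap lp am lm)) ∧
    ¬ ContDiff ℝ N (bilateralGammaPDF ap lp am lm) ∧
    (∀ g : ℝ → ℝ, IsBilateralGammaDensity ap lp am lm g → ¬ ContDiff ℝ N g) := by
  refine ⟨isBilateralGammaDensity_bilateralGammaPDF hap hlp ham hlm,
    contDiffOn_bilateralGammaPDF N hap hlp ham hlm, ?_,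
    not_contDiff_of_eqOn_bilateralGammaPDF N hap hlp ham hlm hN₂ (eqOn_refl _ _), ?_⟩
  · rintro m rfl
    exact contDiff_bilateralGammaPDF m hap hlp ham hlm (by exact_mod_cast hN₁)
  · intro g hg h
    exact not_contDiff_of_eqOn_bilateralGammaPDF N hap hlp ham hlm hN₂
      (hg.eqOn_bilateralGammaPDF hap hlp ham hlm h.continuous) h
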